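/- Let $q=2^h$ with $h\ge 4$, let $k\ge 2$, and let $H_\infty=\mathrm{PG}(2k-1,q)$ be a hyperplane (the hyperplane at infinity) of $\mathrm{PG}(2k,q)$; points outside $H_\infty$ are called affine. Let $\mathcal Q$ be a set of $q^k$ affine points, and let $D=\{P_1P_2\cap H_\infty : P_1,P_2\in\mathcal Q,\ P_1\ne P_2\}$ be the set of directions determined by $\mathcal Q$. Suppose that $|D|=q^k-1$ and that every line meets $D$ in $0$, $1$, $3$ or $q-1$ points. Then: 1. $D$ is an $\mathbb F_2$-linear set of rank $hk$ of $H_\infty$: writing $H_\infty=\mathrm{PG}(E)$ with $E$ a $2k$-dimensional $\mathbb F_q$-vector space, there is an $\mathbb F_2$-subspace $U$ of $E$ of dimension $hk$ with $D=\{\langle u\rangle_{\mathbb F_q} : u\in U\setminus\{0\}\}$. 2. $D$ is a maximum scattered $\mathbb F_2$-linear set, that is, $U$ can be chosen with $\dim_{\mathbb F_2} U=hk$ (half of $\dim_{\mathbb F_2}E=2hk$) and $\dim_{\mathbb F_2}(U\cap\langle v\rangle_{\mathbb F_q})\le 1$ for every $v\in E\setminus\{0\}$. 3. In the Barlotti–Cofman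 representation of $\mathrm{PG}(2k,q)$ in $\mathrm{PG}(2hk,2)$, the affine points corresponding to the points of $\mathcal Q$, together with the directions that they determine in the hyperplane at infinity of $\mathrm{PG}(2hk,2)$, form an $hk$-dimensional projective subspace. Here, if $\mathrm{PG}(2k,q)=\mathrm{PG}(V)$ and $\varphi$ is any $\mathbb F_q$-linear form on $V$ with kernel $E$, the representation is given by the $(2hk+1)$-dimensional $\mathbb F_2$-space $\{v\in V:\varphi(v)\in\mathbb F_2\}$ with hyperplane at infinity $E$; the affine point $\langle w\rangle_{\mathbb F_q}$ with $\varphi(w)=1$ corresponds to $\langle w\rangle_{\mathbb F_2}$, and the point $\langle v\rangle_{\mathbb F_q}$ of $H_\infty$ corresponds to the spread element of points $\langle\lambda v\rangle_{\mathbb F_2}$, $\lambda\in\mathbb F_q^*$. -/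

import Mathlib

open scoped LinearAlgebra.Projectivization

namespace FinGeom

section Projective

variable {K V : Type*} [Field K] [AddCommGroup V] [Module K V]

/-- The set of points of the projective space `PG(V)` that lie in the projective subspace defined
by the vector subspace `W`. -/
def pointsOf (W : Submodule K V) : Set (ℙ K V) :=
  {P | P.submodule ≤ W}

/-- `T` is (the point set of) a `d`-dimensional projective subspace of `PG(V)`.  Lines are the case
`d = 1`. -/
def IsProjSubspace (d : ℕ) (T : Set (ℙ K V)) : Prop :=
  ∃ W : Submodule K V, Module.finrank K W = d + 1 ∧ T = pointsOf W

/-- The directions determined by a set `Q` of points, with respect to the hyperplane at infinity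
defined by `H`: the points at infinity of the lines `P₁P₂` through two different points of `Q`. -/
def directions (H : Submodule K V) (Q : Set (ℙ K V)) : Set (ℙ K V) :=
  {R | R ∈ pointsOf H ∧
    ∃ P₁ ∈ Q, ∃ P₂ ∈ Q, P₁ ≠ P₂ ∧ R.submodule ≤ P₁.submodule ⊔ P₂.submodule}

/-- A set of points of `PG(V)`, restricted to the projective space `PG(H)` of a vector
subspace `H`. -/
def restrictTo (H : Submodule K V) (T : Set (ℙ K V)) : Set (ℙ K H) :=
  Projectivization.map H.subtype H.injective_subtype ⁻¹' T

end Projective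

section LinearSets

variable (K : Type*) {F E : Type*} [Field K] [Field F] [Algebra K F]
  [AddCommGroup E] [Module F E] [Module K E] [IsScalarTower K F E]

/-- `L_U`: the set of points `⟨u⟩_F` of `PG(E)`, for `u` a nonzero vector of the `K`-subspace `U`
of the `F`-vector space `E`. -/
def linearSet (U : Submodule K E) : Set (ℙ F E) :=
  {P | ∃ (u : E) (hu : u ≠ 0), u ∈ U ∧ P = Projectivization.mk F u hu}

/-- `T` is a `K`-linear set of rank `t` of the projective space `PG(E)` over `F`. -/
def IsLinearSet (t : ℕ) (T : Set (ℙ F E)) : Prop :=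
  ∃ U : Submodule K E, Module.finrank K U = t ∧ T = linearSet K U

/-- `U` is scattered: as a projective subspace over `K`, it meets each element of the Desarguesian
spread `{P.submodule | P a point of PG(E)}` in at most one point. -/
def IsScattered (F : Type*) {E : Type*} [Field F] [Algebra K F]
    [AddCommGroup E] [Module F E] [Module K E] [IsScalarTower K F E] (U : Submodule K E) : Prop :=
  ∀ P : ℙ F E, Module.finrank K ↥(U ⊓ P.submodule.restrictScalars K) ≤ 1

/-- `T` is a maximum scattered `K`-linear set of `PG(E) = PG(r - 1, |K| ^ n)`, where `r = dim_F E`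
and `n = [F : K]`: it is a scattered linear set of rank `r n / 2`. -/
def IsMaximumScattered (T : Set (ℙ F E)) : Prop :=
  ∃ U : Submodule K E, T = linearSet K U ∧ IsScattered K F U ∧
    2 * Module.finrank K U = Module.finrank F E * Module.finrank K F

end LinearSets

section BarlottiCofman

variable (K : Type*) {F V : Type*} [Field K] [Field F] [Algebra K F]
  [AddCommGroup V] [Module F V] [Module K V] [IsScalarTower K F V]

/-- The `K`-vector space `{v | φ v ∈ K}` underlying the Barlotti-Cofman representation of `PG(V)`
with hyperplane at infinity `ker φ`.  It contains `ker φ` as a `K`-hyperplane, and for `P` a point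
at infinity of `PG(V)` the vector subspaces `P.submodule ≤ ker φ`, seen over `K`, are the elements
of a Desarguesian spread of that hyperplane. -/
def bcSpace (φ : V →ₗ[F] F) : Submodule K V :=
  (LinearMap.range (Algebra.linearMap K F)).comap (φ.restrictScalars K)

/-- The hyperplane at infinity of the Barlotti-Cofman representation. -/
def bcInfinity (φ : V →ₗ[F] F) : Submodule K (bcSpace K φ) :=
  ((LinearMap.ker φ).restrictScalars K).comap (bcSpace K φ).subtype

/-- The affine points of the Barlotti-Cofman representation that correspond to the points of a set
`Q` of affine points: the affine point `⟨w⟩_F`, normalised by `φ w = 1`, corresponds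
to `⟨w⟩_K`. -/
def bcLift (φ : V →ₗ[F] F) (Q : Set (ℙ F V)) : Set (ℙ K (bcSpace K φ)) :=
  {p | ∃ (w : bcSpace K φ) (hw : w ≠ 0), φ w = 1 ∧ p = Projectivization.mk K w hw ∧
    Projectivization.mk F (w : V) (fun h => hw (Subtype.ext h)) ∈ Q}

end BarlottiCofman

end FinGeom

/-!
Normalised by a linear form `φ` with kernel `H`, the points of `Q` become a set `A` of `q ^ k`
vectors with `φ = 1`, and `D` becomes the set of lines spanned by the differences of vectors of `A`.
Everything follows once `A` is known to be a coset of an additive group `U`: then `D` is the linear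
set of `U`, which is scattered because `U` has as many nonzero vectors as `D` has points, and `U`
together with its coset `A` is an `𝔽₂`-subspace one dimension larger.

*Each vector of `A` sees each direction exactly once* (`FewDirections.eq_of_collinear`,
`FewDirections.exists_span_sub_eq`).  Three collinear vectors of `A` would force `q - 1` directions
in every plane through their line and a further vector of `A`, which is more than `q ^ k - 1` in
total.  So `#A - 1 = #D` different directions are seen from each vector of `A`.  Consequently all
translates of a subspace `S` that meet `A` meet it in equally many vectors, one more than the number
of directions in `S`, and this number divides `q ^ k`, hence is a power of two
(`FewDirections.card_inter_eq_two_pow`).  Translate `A` so that it contains `0`.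

*Small planes are parallelograms* (`FewDirections.add_mem_of_card_eq_four`).  A vector plane with
three directions meets `A` in `0`, `y`, `z` and one vector seen from `y` in the direction of `z` and
from `z` in the direction of `y`, that is, `y + z`.

*Big planes meet in `0` only* (`FewDirections.big_plane_unique`).  Two different planes with `q - 1`
directions and a common nonzero vector span a three-dimensional space, in which the nonzero vectors
of `A` form a linear space with blocks of size `3` and `q - 1`, at most `q + 1` of them through a
point, on `2 ^ e - 1` points.  Counting along the `a` blocks of size `3` and the `b` blocks of size `q - 1`
through a point gives `2 ^ e = 2 a + (q - 2) b + 2`, and a big block that misses the point gives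
`q - 1 ≤ a + b`.  For `b ≥ 1` these conditions leave only `b = q / 2` and `2 ^ e = q ^ 2 / 2`
(`big_count_of_two_pow`), and then `b = 0` occurs at no point; double counting of incidences with
big blocks then contradicts divisibility by `q - 1` (`big_block_unique`).

*Sums in a big plane* are computed by leaving it (`FewDirections.add_mem`): for `w ∈ A` outside,
`y + z = ((w + y) + z) + w`, and each of these three sums is formed in another plane that shares a
nonzero vector with the big plane, and so is small.
-/

namespace FinGeom

/-! ### Linear spaces with blocks of size `3` and `q - 1` -/

section LinearSpace

theorem two_pow_le_or_two_mul_le (s i : ℕ) : 2 ^ i ≤ 2 ^ s ∨ 2 * 2 ^ s ≤ 2 ^ i := by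
  rw [← pow_succ']
  rcases Nat.lt_or_ge s i with h | h
  · exact Or.inr (Nat.pow_le_pow_right (by norm_num) h)
  · exact Or.inl (Nat.pow_le_pow_right (by norm_num) h)

/-- The numbers `a` of blocks of size `3` and `b` of blocks of size `q - 1` through a point satisfy
these conditions.  With `a + b = q - 1 + ε`, the count reads `2 ^ e = 2 q + 2 ε + (q - 4) b`; as `q`
divides `2 ^ e`, this makes `b` a multiple of `q / 4` or one more, and of the few values left only
`b = q / 2` gives a power of two. -/
theorem big_count_of_two_pow {h q e a b : ℕ} (hh : 4 ≤ h) (hq : q = 2 ^ h) (hb : 1 ≤ b)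
    (hM : 2 ^ e = 2 * a + (q - 2) * b + 2) (hlt : q < 2 ^ e)
    (h₁ : q - 1 ≤ a + b) (h₂ : a + b ≤ q + 1) : 2 * b = q ∧ 2 * 2 ^ e = q ^ 2 := by
  obtain ⟨s, rfl⟩ : ∃ s, h = s + 2 := ⟨h - 2, by omega⟩
  have hs : 2 ^ 2 ≤ 2 ^ s := Nat.pow_le_pow_right (by norm_num) (by omega)
  have hq4 : q = 4 * 2 ^ s := by rw [hq, pow_add]; ring
  have he : s + 2 < e := by
    rw [hq] at hlt
    exact (Nat.pow_lt_pow_iff_right (by norm_num : 1 < 2)).1 hlt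
  obtain ⟨i, rfl⟩ : ∃ i, e = s + 2 + i := ⟨e - (s + 2), by omega⟩
  have hM' : 2 ^ (s + 2 + i) = 4 * 2 ^ s * 2 ^ i := by rw [pow_add, pow_add]; ring
  rw [hM'] at hM hlt ⊢
  -- `2 ^ i` is not strictly between `2 ^ t` and `2 ^ (t + 1)`
  have k1 := two_pow_le_or_two_mul_le 1 i
  have k2 := two_pow_le_or_two_mul_le s i
  have k3 := two_pow_le_or_two_mul_le (s + 1) i
  rw [pow_succ] at k3
  subst hq4
  generalize 2 ^ s = p at *
  generalize 2 ^ i = c at *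
  obtain ⟨ε, hε⟩ : ∃ ε, a + b = 4 * p - 1 + ε := ⟨a + b - (4 * p - 1), by omega⟩
  have hε2 : ε ≤ 2 := by omega
  -- the count over `ℤ`, in terms of `b` and `ε` alone
  have hZ : (4 * p * c : ℤ) = 8 * p + 2 * ε + (4 * p - 4) * b := by
    have e1 : ((4 * p * c : ℕ) : ℤ) = 2 * a + (4 * p - 2) * b + 2 := by
      rw [hM]; push_cast [Nat.cast_sub (by omega : 2 ≤ 4 * p)]; ring
    have e2 : (a + b : ℤ) = 4 * p - 1 + ε := by omega
    push_cast at e1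
    rw [e1]
    linear_combination 2 * e2
  obtain ⟨δ, hδ⟩ : ∃ δ : ℤ, (ε : ℤ) = 2 * δ := by
    have : (2 * (2 * p * c - 4 * p - (2 * p - 2) * b) : ℤ) = 2 * ε := by linear_combination hZ
    exact ⟨p * c - 2 * p - (p - 1) * b, by linarith⟩
  have hδ' : δ = 0 ∨ δ = 1 := by omega
  obtain ⟨j, hj⟩ : ∃ j : ℤ, (b : ℤ) = δ + p * j :=
    ⟨2 + b - c, by rw [hδ] at hZ; linarith⟩
  have hp : (0 : ℤ) < p := by omega
  have hc : (c : ℤ) = 2 + δ + (p - 1) * j := by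
    have : (4 * p : ℤ) * c = 4 * p * (2 + δ + (p - 1) * j) := by
      rw [hZ, hδ, hj]; ring
    exact mul_left_cancel₀ (by omega) this
  have hj0 : 0 ≤ j := by
    by_contra hneg
    have : p * j ≤ p * (-1) := mul_le_mul_of_nonneg_left (by omega) hp.le
    omega
  have hj4 : j ≤ 4 := by
    by_contra hneg
    have : (p : ℤ) * 5 ≤ p * j := mul_le_mul_of_nonneg_left (by omega) hp.le
    omega
  have main : δ = 0 ∧ j = 2 := by
    rcases hδ' with rfl | rfl <;> interval_cases j <;> omega
  obtain ⟨rfl, rfl⟩ := main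
  refine ⟨by omega, ?_⟩
  have : c = 2 * p := by omega
  subst this
  ring

open Finset

variable {α : Type*} [DecidableEq α] {D : Finset α} {𝓑 : Finset (Finset α)}

/-- The blocks through `x` partition the other points. -/
theorem sum_card_sub_one_blocks (hsub : ∀ B ∈ 𝓑, B ⊆ D)
    (hcov : ∀ x ∈ D, ∀ y ∈ D, x ≠ y → ∃ B ∈ 𝓑, x ∈ B ∧ y ∈ B)
    (huniq : ∀ B ∈ 𝓑, ∀ B' ∈ 𝓑, ∀ x y, x ≠ y → x ∈ B → y ∈ B → x ∈ B' → y ∈ B' → B = B')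
    {x : α} (hx : x ∈ D) : ∑ B ∈ 𝓑 with x ∈ B, (#B - 1) = #D - 1 := by
  have h : D.erase x = ({B ∈ 𝓑 | x ∈ B} : Finset _).biUnion fun B => B.erase x := by
    ext y
    simp only [mem_erase, mem_biUnion, mem_filter]
    constructor
    · rintro ⟨hyx, hy⟩
      obtain ⟨B, hB, hxB, hyB⟩ := hcov x hx y hy hyx.symm
      exact ⟨B, ⟨hB, hxB⟩, hyx, hyB⟩
    · rintro ⟨B, ⟨hB, -⟩, hyx, hyB⟩
      exact ⟨hyx, hsub B hB hyB⟩
  rw [← card_erase_of_mem hx, h, card_biUnion]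
  · refine sum_congr rfl fun B hB => ?_
    rw [card_erase_of_mem (mem_filter.1 hB).2]
  · intro B hB B' hB' hne
    rw [mem_coe, mem_filter] at hB hB'
    refine disjoint_left.2 fun y hy hy' => hne ?_
    rw [mem_erase] at hy hy'
    exact huniq B hB.1 B' hB'.1 x y hy.1.symm hB.2 hy.2 hB'.2 hy'.2

/-- The points of a block that misses `x` are joined to `x` by different blocks. -/
theorem card_le_card_blocks_through
    (hcov : ∀ x ∈ D, ∀ y ∈ D, x ≠ y → ∃ B ∈ 𝓑, x ∈ B ∧ y ∈ B)
    (huniq : ∀ B ∈ 𝓑, ∀ B' ∈ 𝓑, ∀ x y, x ≠ y → x ∈ B → y ∈ B → x ∈ B' → y ∈ B' → B = B')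
    (hsub : ∀ B ∈ 𝓑, B ⊆ D)
    {x : α} (hx : x ∈ D) {B : Finset α} (hB : B ∈ 𝓑) (hxB : x ∉ B) :
    #B ≤ #{B' ∈ 𝓑 | x ∈ B'} := by
  have : ∀ y : α, ∃ B', y ∈ B → B' ∈ 𝓑 ∧ x ∈ B' ∧ y ∈ B' := by
    intro y
    by_cases hy : y ∈ B
    · obtain ⟨B', h⟩ := hcov x hx y (hsub B hB hy) (fun h => hxB (h ▸ hy))
      exact ⟨B', fun _ => h⟩
    · exact ⟨∅, fun h => absurd h hy⟩
  choose f hf using this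
  refine card_le_card_of_injOn f (fun y hy => ?_) (fun y hy z hz hyz => ?_)
  · have := hf y hy
    simp [this.1, this.2.1]
  · by_contra hne
    have h₁ := hf y hy
    have h₂ := hf z hz
    rw [← hyz] at h₂
    exact hxB (huniq B hB (f y) h₁.1 y z hne hy hz h₁.2.2 h₂.2.2 ▸ h₁.2.1)

/-- A linear space on `2 ^ e - 1` points, with blocks of size `3` and `q - 1` and at most `q + 1`
blocks through each point, has at most one block of size `q - 1`.  With two of them, each point
would lie on exactly `q / 2`, and there would be `q ^ 2 / 2 - 1` points; but then the number of incidences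
of points and big blocks is not divisible by `q - 1`. -/
theorem big_block_unique {h q e : ℕ} (hh : 4 ≤ h) (hq : q = 2 ^ h)
    (hsub : ∀ B ∈ 𝓑, B ⊆ D)
    (hcov : ∀ x ∈ D, ∀ y ∈ D, x ≠ y → ∃ B ∈ 𝓑, x ∈ B ∧ y ∈ B)
    (huniq : ∀ B ∈ 𝓑, ∀ B' ∈ 𝓑, ∀ x y, x ≠ y → x ∈ B → y ∈ B → x ∈ B' → y ∈ B' → B = B')
    (hsize : ∀ B ∈ 𝓑, #B = 3 ∨ #B = q - 1)
    (hdeg : ∀ x ∈ D, #{B ∈ 𝓑 | x ∈ B} ≤ q + 1) (hcard : #D + 1 = 2 ^ e)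
    {B₁ B₂ : Finset α} (h₁ : B₁ ∈ 𝓑) (h₂ : B₂ ∈ 𝓑) (hB₁ : #B₁ = q - 1) (hB₂ : #B₂ = q - 1) :
    B₁ = B₂ := by
  by_contra hne
  have hq16 : 16 ≤ q := by
    rw [hq]; exact (by norm_num : 16 = 2 ^ 4).le.trans (Nat.pow_le_pow_right (by norm_num) hh)
  -- `b x` is the number of blocks of size `q - 1` through `x`
  let b : α → ℕ := fun x => #{B ∈ {B ∈ 𝓑 | #B = q - 1} | x ∈ B}
  -- two big blocks already contain `2 q - 3` points
  have hN : q < 2 ^ e := by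
    have hi : #(B₁ ∩ B₂) ≤ 1 := by
      refine card_le_one.2 fun x hx y hy => ?_
      by_contra hxy
      rw [mem_inter] at hx hy
      exact hne (huniq _ h₁ _ h₂ x y hxy hx.1 hy.1 hx.2 hy.2)
    have hu : #(B₁ ∪ B₂) ≤ #D := card_le_card (union_subset (hsub _ h₁) (hsub _ h₂))
    have := card_union_add_card_inter B₁ B₂
    omega
  have count : ∀ x ∈ D, ∃ a, a + b x = #{B ∈ 𝓑 | x ∈ B} ∧
      2 ^ e = 2 * a + (q - 2) * b x + 2 := by
    intro x hx
    refine ⟨#{B ∈ {B ∈ 𝓑 | x ∈ B} | ¬ #B = q - 1}, ?_, ?_⟩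
    · rw [add_comm, ← card_filter_add_card_filter_not (s := {B ∈ 𝓑 | x ∈ B})
        (fun B => #B = q - 1)]
      simp only [b, filter_filter, and_comm]
    · have hs := sum_card_sub_one_blocks hsub hcov huniq hx
      rw [← sum_filter_add_sum_filter_not _ (fun B => #B = q - 1)] at hs
      rw [sum_const_nat (m := q - 2), sum_const_nat (m := 2)] at hs
      · have : b x = #{B ∈ {B ∈ 𝓑 | x ∈ B} | #B = q - 1} := by
          simp only [b, filter_filter, and_comm]
        rw [this, ← hcard]
        have : 0 < #D := card_pos.2 ⟨x, hx⟩
        rw [mul_comm 2, mul_comm (q - 2)]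
        omega
      · intro B hB
        simp only [mem_filter] at hB
        have := hsize B hB.1.1
        omega
      · intro B hB
        simp only [mem_filter] at hB
        omega
  -- a big block that misses `x` bounds the number of blocks through `x` from below
  have arith : ∀ x ∈ D, (∃ B ∈ 𝓑, #B = q - 1 ∧ x ∉ B) → 1 ≤ b x →
      2 * b x = q ∧ 2 * 2 ^ e = q ^ 2 := by
    rintro x hx ⟨B, hB, hBc, hxB⟩ hb
    obtain ⟨a, ha, hM⟩ := count x hx
    refine big_count_of_two_pow hh hq hb hM hN ?_ (ha ▸ hdeg x hx)
    rw [ha, ← hBc]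
    exact card_le_card_blocks_through hcov huniq hsub hx hB hxB
  have b_pos : ∀ x, ∀ B ∈ 𝓑, #B = q - 1 → x ∈ B → 1 ≤ b x := fun x B hB hBc hxB =>
    card_pos.2 ⟨B, by simp [hB, hBc, hxB]⟩
  obtain ⟨y, hy₁, hy₂⟩ : ∃ y ∈ B₁, y ∉ B₂ := by
    by_contra hcon
    push Not at hcon
    exact hne (eq_of_subset_of_card_le hcon (by omega))
  have hyD := hsub _ h₁ hy₁
  obtain ⟨hby, hM⟩ := arith y hyD ⟨B₂, h₂, hB₂, hy₂⟩ (b_pos y B₁ h₁ hB₁ hy₁)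
  have avoid : ∀ x ∈ D, ∃ B ∈ 𝓑, #B = q - 1 ∧ x ∉ B := by
    intro x hx
    by_cases hx₁ : x ∈ B₁
    · -- the point `y` lies on `q / 2 ≥ 2` big blocks, at most one of which passes through `x`
      by_cases hxy : x = y
      · exact ⟨B₂, h₂, hB₂, hxy ▸ hy₂⟩
      have : 1 < b y := by omega
      obtain ⟨B, hB, hBne⟩ := exists_mem_ne this B₁
      simp only [mem_filter] at hB
      exact ⟨B, hB.1.1, hB.1.2, fun hxB =>
        hBne (huniq _ hB.1.1 _ h₁ x y hxy hxB hB.2 hx₁ hy₁)⟩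
    · exact ⟨B₁, h₁, hB₁, hx₁⟩
  have half : ∀ x ∈ D, 2 * b x = q := by
    intro x hx
    refine (arith x hx (avoid x hx) ?_).1
    by_contra hb
    obtain ⟨a, ha, hM'⟩ := count x hx
    have hb0 : b x = 0 := by omega
    rw [hb0] at hM' ha
    have := hdeg x hx
    nlinarith
  -- double counting of the incidences between `D` and the big blocks
  have dc : ∑ x ∈ D, b x = ∑ B ∈ 𝓑 with #B = q - 1, #{x ∈ D | x ∈ B} :=
    sum_card_bipartiteAbove_eq_sum_card_bipartiteBelow (fun x B => x ∈ B)
  rw [sum_const_nat (s := {B ∈ 𝓑 | #B = q - 1}) (m := q - 1)] at dc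
  · have h2 : #D * q = 2 * (#{B ∈ 𝓑 | #B = q - 1} * (q - 1)) := by
      rw [← dc, mul_sum, sum_const_nat half]
    generalize #{B ∈ 𝓑 | #B = q - 1} = t at h2
    obtain ⟨r, rfl⟩ : ∃ r, q = r + 1 := ⟨q - 1, by omega⟩
    simp only [Nat.add_sub_cancel] at h2
    rw [← hcard] at hM
    -- `(q ^ 2 - 2) q` is congruent to `-1` modulo `q - 1 = r`
    have : (r : ℤ) ∣ 1 := by
      refine ⟨r ^ 2 + 3 * r + 1 - 4 * t, ?_⟩
      have h2' : (#D * (r + 1) : ℤ) = 2 * (t * r) := by exact_mod_cast h2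
      have hM' : (2 * (#D + 1) : ℤ) = (r + 1) ^ 2 := by exact_mod_cast hM
      linear_combination (-2) * h2' + (r + 1) * hM'
    have := Int.le_of_dvd one_pos this
    omega
  · intro B hB
    rw [mem_filter] at hB
    rw [← hB.2]
    congr 1
    ext x
    simpa using fun hx => hsub B hB.1 hx

end LinearSpace

/-! ### Directions of sets of vectors -/

section AffineSets

open Finset
open scoped Classical

section Basic

variable {F V : Type*} [Field F] [AddCommGroup V] [Module F V]

theorem span_singleton_eq_of_mem {u v : V} (hv : v ≠ 0) (h : v ∈ Submodule.span F {u}) :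
    Submodule.span F {v} = Submodule.span F {u} := by
  obtain ⟨c, rfl⟩ := Submodule.mem_span_singleton.1 h
  have hc : c ≠ 0 := fun h0 => hv (by simp [h0])
  exact Submodule.span_singleton_smul_eq (IsUnit.mk0 c hc) u

theorem finrank_sup_span_singleton {u v : V} (hu : u ≠ 0) (hv : v ∉ Submodule.span F {u}) :
    Module.finrank F ↥(Submodule.span F {u} ⊔ Submodule.span F {v}) = 2 := by
  have hli : LinearIndependent F ![u, v] := by
    rw [LinearIndependent.pair_iff' hu]
    exact fun a ha => hv (Submodule.mem_span_singleton.2 ⟨a, ha⟩)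
  have := finrank_span_eq_card hli
  rw [← Submodule.span_union, Set.singleton_union]
  rwa [Matrix.range_cons_cons_empty, Fintype.card_fin] at this

theorem sup_span_singleton_eq [FiniteDimensional F V] {u v : V} {W : Submodule F V}
    (hu : u ≠ 0) (hv : v ∉ Submodule.span F {u})
    (hW : Module.finrank F W = 2) (huW : u ∈ W) (hvW : v ∈ W) :
    Submodule.span F {u} ⊔ Submodule.span F {v} = W := by
  refine Submodule.eq_of_le_of_finrank_eq (sup_le ?_ ?_) ?_
  · simpa using huW
  · simpa using hvW
  · rw [finrank_sup_span_singleton hu hv, hW]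

theorem mem_sup_left {u v : V} : u ∈ Submodule.span F {u} ⊔ Submodule.span F {v} :=
  Submodule.mem_sup_left (Submodule.mem_span_singleton_self u)

theorem mem_sup_right {u v : V} : v ∈ Submodule.span F {u} ⊔ Submodule.span F {v} :=
  Submodule.mem_sup_right (Submodule.mem_span_singleton_self v)

theorem card_filter_mem_submodule [Fintype F] [Fintype V] (W : Submodule F V) :
    #{v : V | v ∈ W} = Fintype.card F ^ Module.finrank F W := by
  rw [← Nat.card_eq_fintype_card, ← Module.natCard_eq_pow_finrank (K := F) (V := W),
    Nat.card_eq_fintype_card, Fintype.card_subtype]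

variable (F) in
/-- The directions determined by a finite set of vectors: the lines through `0` spanned by the
differences of two different vectors of the set. -/
noncomputable def dirs (A : Finset V) : Finset (Submodule F V) :=
  A.offDiag.image fun p => Submodule.span F {p.1 - p.2}

theorem span_sub_mem_dirs {A : Finset V} {x y : V} (hx : x ∈ A) (hy : y ∈ A) (h : x ≠ y) :
    Submodule.span F {x - y} ∈ dirs F A :=
  mem_image.2 ⟨(x, y), mem_offDiag.2 ⟨hx, hy, h⟩, rfl⟩

theorem mem_dirs {A : Finset V} {L : Submodule F V} :
    L ∈ dirs F A ↔ ∃ x ∈ A, ∃ y ∈ A, x ≠ y ∧ L = Submodule.span F {x - y} := by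
  simp only [dirs, mem_image, mem_offDiag, Prod.exists]
  constructor
  · rintro ⟨x, y, ⟨hx, hy, h⟩, rfl⟩
    exact ⟨x, hx, y, hy, h, rfl⟩
  · rintro ⟨x, hx, y, hy, h, rfl⟩
    exact ⟨x, y, ⟨hx, hy, h⟩, rfl⟩

theorem dirs_image_sub (A : Finset V) (x : V) : dirs F (A.image (· - x)) = dirs F A := by
  ext L
  simp only [mem_dirs, mem_image]
  constructor
  · rintro ⟨_, ⟨a, ha, rfl⟩, _, ⟨b, hb, rfl⟩, h, rfl⟩
    exact ⟨a, ha, b, hb, fun hab => h (by rw [hab]), by rw [sub_sub_sub_cancel_right]⟩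
  · rintro ⟨a, ha, b, hb, h, rfl⟩
    exact ⟨_, ⟨a, ha, rfl⟩, _, ⟨b, hb, rfl⟩, fun hab => h (sub_left_injective hab),
      by rw [sub_sub_sub_cancel_right]⟩

/-- If a vector plane `W` contains at most `q - 1` directions of `A`, each translate of `W` contains
at most `q` vectors of `A`: some line of `W` is not a direction, and its translates meet `A` in at
most one vector. -/
theorem card_inter_translate_le [Fintype F] [Fintype V] {A : Finset V} {W : Submodule F V}
    (hW : Module.finrank F W = 2) (hdir : #{L ∈ dirs F A | L ≤ W} ≤ Fintype.card F - 1) (x : V) :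
    #{y ∈ A | y - x ∈ W} ≤ Fintype.card F := by
  have hq : 1 < Fintype.card F := Fintype.one_lt_card
  obtain ⟨v, hvW, hv0, hv⟩ : ∃ v ∈ W, v ≠ 0 ∧ Submodule.span F {v} ∉ dirs F A := by
    by_contra hcon
    push Not at hcon
    have h₁ : #(({v : V | v ∈ W} : Finset V).erase 0) ≤
        (Fintype.card F - 1) * #{L ∈ dirs F A | L ≤ W} := by
      refine card_le_mul_card_image_of_maps_to (f := fun v => Submodule.span F {v}) ?_ _ ?_
      · intro v hv
        simp only [mem_erase, mem_filter, mem_univ, true_and] at hv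
        simp [hcon v hv.2 hv.1, hv.2]
      · intro L hL
        obtain ⟨a, -, b, -, hab, rfl⟩ := mem_dirs.1 (mem_filter.1 hL).1
        have : #(({w : V | w ∈ Submodule.span F {a - b}} : Finset V).erase 0) =
            Fintype.card F - 1 := by
          rw [card_erase_of_mem (by simp), card_filter_mem_submodule,
            finrank_span_singleton (sub_ne_zero.2 hab), pow_one]
        rw [← this]
        refine card_le_card fun w hw => ?_
        simp only [mem_filter, mem_erase, mem_univ, true_and] at hw ⊢
        exact ⟨hw.1.1, hw.2 ▸ Submodule.mem_span_singleton_self w⟩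
    rw [card_erase_of_mem (by simp), card_filter_mem_submodule, hW] at h₁
    have h₂ := h₁.trans (Nat.mul_le_mul_left _ hdir)
    obtain ⟨r, hr⟩ : ∃ r, Fintype.card F = r + 1 := ⟨Fintype.card F - 1, by omega⟩
    rw [hr] at h₂ hq
    simp only [Nat.add_sub_cancel] at h₂
    have : (r + 1) ^ 2 = r * r + 2 * r + 1 := by ring
    omega
  -- distinct vectors of `A` lie on distinct translates of the line of `v`
  have hinj : #({y ∈ A | y - x ∈ W} ×ˢ (univ : Finset F)) ≤ #{w : V | w ∈ W} := by
    refine card_le_card_of_injOn (fun p => p.1 - x + p.2 • v) ?_ ?_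
    · rintro ⟨y, c⟩ hp
      simp only [coe_product, coe_filter, coe_univ, Set.mem_prod, Set.mem_ofPred_eq] at hp
      simpa using W.add_mem hp.1.2 (W.smul_mem c hvW)
    · rintro ⟨y, c⟩ hp ⟨z, d⟩ hp' heq
      simp only [coe_product, coe_filter, coe_univ, Set.mem_prod, Set.mem_ofPred_eq] at hp hp' heq
      have hsub : y - z = (d - c) • v := by
        rw [sub_smul]; linear_combination (norm := module) heq
      by_cases hyz : y = z
      · subst hyz
        rw [sub_self, eq_comm, smul_eq_zero, or_iff_left hv0, sub_eq_zero] at hsub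
        rw [hsub]
      · refine absurd (span_sub_mem_dirs (F := F) hp.1.1 hp'.1.1 hyz) ?_
        rwa [span_singleton_eq_of_mem (sub_ne_zero.2 hyz)
          (Submodule.mem_span_singleton.2 ⟨d - c, hsub.symm⟩)]
  rw [card_product, card_univ, card_filter_mem_submodule, hW, sq] at hinj
  exact Nat.le_of_mul_le_mul_right hinj (by omega)

end Basic

/-! ### Sets with few directions -/

/-- A set of `q ^ k` vectors that determines `q ^ k - 1` directions, such that each vector plane
contains `0`, `1`, `3` or `q - 1` of these directions; here `q = 2 ^ h` is the order of the scalar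
field, with `h ≥ 4`, and `k ≥ 2`. -/
structure FewDirections (F : Type*) {V : Type*} [Field F] [Fintype F] [AddCommGroup V] [Module F V]
    (h k q : ℕ) (A : Finset V) : Prop where
  four_le : 4 ≤ h
  two_le : 2 ≤ k
  q_eq : q = 2 ^ h
  card_field : Fintype.card F = q
  card_eq : #A = q ^ k
  card_dirs : #(dirs F A) = q ^ k - 1
  card_plane : ∀ W : Submodule F V, Module.finrank F W = 2 →
    #{L ∈ dirs F A | L ≤ W} = 0 ∨ #{L ∈ dirs F A | L ≤ W} = 1 ∨
      #{L ∈ dirs F A | L ≤ W} = 3 ∨ #{L ∈ dirs F A | L ≤ W} = q - 1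

namespace FewDirections

variable {F V : Type*} [Field F] [Fintype F] [AddCommGroup V] [Module F V]
  {h k q : ℕ} {A : Finset V}

theorem sixteen_le (hA : FewDirections F h k q A) : 16 ≤ q := by
  rw [hA.q_eq]
  exact (by norm_num : 16 = 2 ^ 4).le.trans (Nat.pow_le_pow_right (by norm_num) hA.four_le)

theorem lt_pow (hA : FewDirections F h k q A) : q < q ^ k := by
  have := hA.sixteen_le
  exact lt_self_pow₀ (by omega) (by have := hA.two_le; omega)

theorem image_sub (hA : FewDirections F h k q A) (x : V) :
    FewDirections F h k q (A.image (· - x)) where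
  four_le := hA.four_le
  two_le := hA.two_le
  q_eq := hA.q_eq
  card_field := hA.card_field
  card_eq := by rw [card_image_of_injective _ sub_left_injective, hA.card_eq]
  card_dirs := by rw [dirs_image_sub, hA.card_dirs]
  card_plane := by rw [dirs_image_sub]; exact hA.card_plane

variable [Fintype V]

/-- No three vectors of `A` are affinely collinear.  If `r ≥ 3` of them lie on a line, every
plane through this line and a further vector of `A` has at least four directions, hence `q - 1`;
it contains at most `q - r` vectors of `A` off the line, and `q - 2` directions besides that of
the line.  Summing over these planes gives `(q - 2) (q ^ k - r) ≤ (q - r) (q ^ k - 2)`, which is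
false. -/
theorem eq_of_collinear (hA : FewDirections F h k q A) {x y z : V} (hx : x ∈ A) (hy : y ∈ A)
    (hz : z ∈ A) (hxy : y ≠ x) (hxz : z ≠ x) (hcol : z - x ∈ Submodule.span F {y - x}) :
    z = y := by
  by_contra hzy
  have hq := hA.sixteen_le
  have hqk := hA.lt_pow
  set d := Submodule.span F {y - x} with hd
  have hd0 : y - x ≠ 0 := sub_ne_zero.2 hxy
  have hdmem : d ∈ dirs F A := span_sub_mem_dirs hy hx hxy
  set f : V → Submodule F V := fun w => d ⊔ Submodule.span F {w - x} with hf
  set O : Finset V := {w ∈ A | ¬ w - x ∈ d} with hO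
  set r := #{w ∈ A | w - x ∈ d} with hr
  have hrO : r + #O = q ^ k := by rw [← hA.card_eq, hr, hO, card_filter_add_card_filter_not]
  have hr3 : 3 ≤ r := by
    have : ({x, y, z} : Finset V) ⊆ {w ∈ A | w - x ∈ d} := by
      intro w hw
      simp only [mem_insert, mem_singleton] at hw
      rcases hw with rfl | rfl | rfl
      · simp [hx]
      · simp [hy, hd, Submodule.mem_span_singleton_self]
      · simp [hz, hcol]
    refine le_trans (le_of_eq ?_) (card_le_card this)
    rw [card_eq_three.2 ⟨x, y, z, hxy.symm, hxz.symm, Ne.symm hzy, rfl⟩]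
  have hrank : ∀ w ∈ O, Module.finrank F (f w) = 2 := fun w hw =>
    finrank_sup_span_singleton hd0 (mem_filter.1 hw).2
  have hfull : ∀ w ∈ O, #{L ∈ dirs F A | L ≤ f w} = q - 1 := by
    intro w hw
    obtain ⟨hwA, hwd⟩ := mem_filter.1 hw
    have off : ∀ p, p - x ∈ d → w - p ∉ d := fun p hp hwp =>
      hwd (by simpa using d.add_mem hwp hp)
    have ne : ∀ p, p - x ∈ d → w ≠ p := fun p hp hwp => hwd (hwp ▸ hp)
    have hdne : ∀ p, p - x ∈ d → d ≠ Submodule.span F {w - p} := fun p hp heq =>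
      off p hp (heq ▸ Submodule.mem_span_singleton_self _)
    have hne : ∀ p p', p - x ∈ d → p' - x ∈ d → p ≠ p' →
        Submodule.span F {w - p} ≠ Submodule.span F {w - p'} := by
      intro p p' hp hp' hpp heq
      have h₁ : p - p' ∈ Submodule.span F {w - p} := by
        have h₂ : w - p' ∈ Submodule.span F {w - p} :=
          heq ▸ Submodule.mem_span_singleton_self _
        simpa using Submodule.sub_mem _ h₂ (Submodule.mem_span_singleton_self (w - p))
      have h₂ : p - p' ∈ d := by simpa using d.sub_mem hp hp'
      have h₃ := span_singleton_eq_of_mem (sub_ne_zero.2 hpp) h₁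
      rw [span_singleton_eq_of_mem (sub_ne_zero.2 hpp) h₂] at h₃
      exact hdne p hp h₃
    have hle : ∀ p, p - x ∈ d → p ∈ A →
        Submodule.span F {w - p} ∈ ({L ∈ dirs F A | L ≤ f w} : Finset _) := by
      intro p hp hpA
      refine mem_filter.2 ⟨span_sub_mem_dirs hwA hpA (ne p hp), ?_⟩
      rw [Submodule.span_singleton_le_iff_mem]
      have h₁ : w - x ∈ f w := mem_sup_right
      have h₂ : p - x ∈ f w := Submodule.mem_sup_left hp
      simpa using Submodule.sub_mem _ h₁ h₂
    have hxd : x - x ∈ d := by simp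
    have hyd : y - x ∈ d := Submodule.mem_span_singleton_self _
    have hsub : ({d, Submodule.span F {w - x}, Submodule.span F {w - y},
        Submodule.span F {w - z}} : Finset (Submodule F V)) ⊆
        ({L ∈ dirs F A | L ≤ f w} : Finset _) := by
      intro L hL
      simp only [mem_insert, mem_singleton] at hL
      rcases hL with rfl | rfl | rfl | rfl
      · exact mem_filter.2 ⟨hdmem, le_sup_left⟩
      · exact hle x hxd hx
      · exact hle y hyd hy
      · exact hle z hcol hz
    have h4 := card_le_card hsub
    rw [card_insert_of_notMem, card_insert_of_notMem, card_insert_of_notMem,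
      card_singleton] at h4
    · have := hA.card_plane (f w) (hrank w hw)
      omega
    · simpa using hne y z hyd hcol (Ne.symm hzy)
    · simpa using ⟨hne x y hxd hyd hxy.symm, hne x z hxd hcol hxz.symm⟩
    · simpa using ⟨hdne x hxd, hdne y hyd, hdne z hcol⟩
  have hcard : ∀ w ∈ O, r + #{w' ∈ O | f w' = f w} ≤ q := by
    intro w hw
    have h₁ := card_inter_translate_le (hrank w hw)
      (by rw [hfull w hw, hA.card_field]) x
    rw [hA.card_field, ← card_filter_add_card_filter_not (fun v => v - x ∈ d)] at h₁
    refine le_trans (Nat.add_le_add (card_le_card ?_) (card_le_card ?_)) h₁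
    · intro v hv
      rw [mem_filter] at hv
      simp only [mem_filter]
      exact ⟨⟨hv.1, Submodule.mem_sup_left hv.2⟩, hv.2⟩
    · intro v hv
      simp only [hO, mem_filter] at hv ⊢
      exact ⟨⟨hv.1.1, hv.2 ▸ mem_sup_right⟩, hv.1.2⟩
  have hO0 : O.Nonempty := card_pos.1 (by
    by_contra h0
    have h₁ : #O = 0 := by omega
    have hle : r ≤ #{w : V | w ∈ d} := by
      refine card_le_card_of_injOn (· - x) (fun w hw => ?_) sub_left_injective.injOn
      simpa using (mem_filter.1 hw).2
    rw [card_filter_mem_submodule, finrank_span_singleton hd0, pow_one, hA.card_field] at hle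
    omega)
  obtain ⟨w₀, hw₀⟩ := hO0
  have hrq : r < q := by
    have h₁ := hcard w₀ hw₀
    have : 0 < #{w' ∈ O | f w' = f w₀} := card_pos.2 ⟨w₀, by simp [hw₀]⟩
    omega
  have up : #O ≤ (q - r) * #(O.image f) := by
    refine card_le_mul_card_image _ _ fun W hW => ?_
    obtain ⟨w, hw, rfl⟩ := mem_image.1 hW
    have := hcard w hw
    omega
  have low : (q - 2) * #(O.image f) ≤ q ^ k - 2 := by
    have h₁ : (q - 2) * #(O.image f) ≤ #{L ∈ (dirs F A).erase d | d ⊔ L ∈ O.image f} := by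
      refine mul_card_image_le_card_of_maps_to (f := fun L => d ⊔ L)
        (fun L hL => (mem_filter.1 hL).2) _ fun W hW => ?_
      obtain ⟨w, hw, rfl⟩ := mem_image.1 hW
      have h₂ : #(({L ∈ dirs F A | L ≤ f w} : Finset _).erase d) = q - 2 := by
        rw [card_erase_of_mem (mem_filter.2 ⟨hdmem, le_sup_left⟩), hfull w hw]
        omega
      rw [← h₂]
      refine card_le_card fun L hL => ?_
      simp only [mem_erase, mem_filter] at hL ⊢
      obtain ⟨hLd, hL, hLw⟩ := hL
      have heq : d ⊔ L = f w := by
        obtain ⟨a, -, b, -, hab, rfl⟩ := mem_dirs.1 hL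
        refine sup_span_singleton_eq hd0 (fun hmem => hLd ?_) (hrank w hw) mem_sup_left
          (hLw (Submodule.mem_span_singleton_self _))
        exact span_singleton_eq_of_mem (sub_ne_zero.2 hab) hmem
      exact ⟨⟨⟨hLd, hL⟩, heq ▸ hW⟩, heq⟩
    have h₃ : #((dirs F A).erase d) = q ^ k - 2 := by
      rw [card_erase_of_mem hdmem, hA.card_dirs]; omega
    exact h₁.trans (h₃ ▸ card_le_card (filter_subset _ _))
  generalize #(O.image f) = m at up low
  generalize q ^ k = n at *
  clear_value r
  obtain ⟨s, rfl⟩ : ∃ s, r = s + 3 := ⟨r - 3, by omega⟩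
  obtain ⟨t, rfl⟩ : ∃ t, q = s + 3 + t := ⟨q - (s + 3), by omega⟩
  obtain ⟨u, rfl⟩ : ∃ u, n = s + 3 + t + u := ⟨n - (s + 3 + t), by omega⟩
  have e1 : #O = t + u := by omega
  rw [e1, show s + 3 + t - (s + 3) = t by omega] at up
  rw [show s + 3 + t - 2 = s + 1 + t by omega,
    show s + 3 + t + u - 2 = s + 1 + t + u by omega] at low
  have hu : 0 < u := by omega
  nlinarith [Nat.mul_le_mul_left (s + 1 + t) up, Nat.mul_le_mul_left t low]

theorem injOn_span_sub (hA : FewDirections F h k q A) {x : V} (hx : x ∈ A) :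
    Set.InjOn (fun y => Submodule.span F {y - x}) (A.erase x : Set V) := by
  intro y hy z hz heq
  rw [mem_coe, mem_erase] at hy hz
  refine (hA.eq_of_collinear hx hy.2 hz.2 hy.1 hz.1 ?_).symm
  change _ = _ at heq
  simp only at heq
  rw [heq]
  exact Submodule.mem_span_singleton_self _

/-- Each vector of `A` sees each direction, because it sees as many directions as there are. -/
theorem exists_span_sub_eq (hA : FewDirections F h k q A) {x : V} (hx : x ∈ A)
    {L : Submodule F V} (hL : L ∈ dirs F A) :
    ∃ y ∈ A, y ≠ x ∧ Submodule.span F {y - x} = L := by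
  have him : (A.erase x).image (fun y => Submodule.span F {y - x}) = dirs F A := by
    refine eq_of_subset_of_card_le (fun L hL => ?_) ?_
    · obtain ⟨y, hy, rfl⟩ := mem_image.1 hL
      rw [mem_erase] at hy
      exact span_sub_mem_dirs hy.2 hx hy.1
    · rw [card_image_of_injOn (hA.injOn_span_sub hx), card_erase_of_mem hx, hA.card_eq,
        hA.card_dirs]
  rw [← him, mem_image] at hL
  obtain ⟨y, hy, rfl⟩ := hL
  rw [mem_erase] at hy
  exact ⟨y, hy.2, hy.1, rfl⟩

theorem card_inter_translate (hA : FewDirections F h k q A) {x : V} (hx : x ∈ A)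
    (S : Submodule F V) : #{y ∈ A | y - x ∈ S} = #{L ∈ dirs F A | L ≤ S} + 1 := by
  have him : ({y ∈ A | y - x ∈ S}.erase x).image (fun y => Submodule.span F {y - x}) =
      ({L ∈ dirs F A | L ≤ S} : Finset _) := by
    ext L
    simp only [mem_image, mem_erase, mem_filter]
    constructor
    · rintro ⟨y, ⟨hyx, hy, hyS⟩, rfl⟩
      exact ⟨span_sub_mem_dirs hy hx hyx, by simpa using hyS⟩
    · rintro ⟨hL, hLS⟩
      obtain ⟨y, hy, hyx, rfl⟩ := hA.exists_span_sub_eq hx hL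
      exact ⟨y, ⟨hyx, hy, by simpa using hLS⟩, rfl⟩
  rw [← him, card_image_of_injOn, card_erase_add_one]
  · simp [hx]
  · refine (hA.injOn_span_sub hx).mono fun y hy => ?_
    simp only [coe_erase, coe_filter, Set.mem_sdiff, Set.mem_ofPred_eq, Set.mem_singleton_iff,
      mem_coe] at hy ⊢
    exact ⟨hy.1.1, hy.2⟩

theorem card_inter (hA : FewDirections F h k q A) (h0 : 0 ∈ A) (S : Submodule F V) :
    #{y ∈ A | y ∈ S} = #{L ∈ dirs F A | L ≤ S} + 1 := by
  simpa using hA.card_inter_translate h0 S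

/-- The translates of a subspace `S` that meet `A` all meet it in the same number of vectors, so
this number divides `#A = q ^ k`. -/
theorem card_inter_eq_two_pow (hA : FewDirections F h k q A) (h0 : 0 ∈ A) (S : Submodule F V) :
    ∃ e, #{y ∈ A | y ∈ S} = 2 ^ e := by
  have hdvd : #{y ∈ A | y ∈ S} ∣ #A := by
    rw [card_eq_sum_card_image S.mkQ A, sum_const_nat (m := #{y ∈ A | y ∈ S})]
    · exact Dvd.intro_left _ rfl
    · intro b hb
      obtain ⟨x, hx, rfl⟩ := mem_image.1 hb
      rw [hA.card_inter h0, ← hA.card_inter_translate hx]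
      congr 1
      ext y
      simp only [mem_filter, Submodule.mkQ_apply, Submodule.Quotient.eq]
  rw [hA.card_eq, hA.q_eq, ← pow_mul] at hdvd
  obtain ⟨e, -, he⟩ := (Nat.dvd_prime_pow Nat.prime_two).1 hdvd
  exact ⟨e, he⟩

theorem notMem_span (hA : FewDirections F h k q A) (h0 : 0 ∈ A) {y z : V} (hy : y ∈ A)
    (hz : z ∈ A) (hy0 : y ≠ 0) (hz0 : z ≠ 0) (hyz : y ≠ z) : z ∉ Submodule.span F {y} :=
  fun hmem => hyz (hA.eq_of_collinear h0 hy hz hy0 hz0 (by simpa using hmem)).symm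

theorem card_plane_inter (hA : FewDirections F h k q A) (h0 : 0 ∈ A) {y z : V} (hy : y ∈ A)
    (hz : z ∈ A) (hy0 : y ≠ 0) (hz0 : z ≠ 0) (hyz : y ≠ z) {W : Submodule F V}
    (hW : Module.finrank F W = 2) (hyW : y ∈ W) (hzW : z ∈ W) :
    #{v ∈ A | v ∈ W} = 4 ∨ #{v ∈ A | v ∈ W} = q := by
  have h3 : 3 ≤ #{v ∈ A | v ∈ W} := by
    rw [← card_eq_three.2 ⟨0, y, z, hy0.symm, hz0.symm, hyz, rfl⟩]
    refine card_le_card fun w hw => ?_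
    simp only [mem_insert, mem_singleton] at hw
    rcases hw with rfl | rfl | rfl <;> simp [*]
  have := hA.card_plane W hW
  have := hA.card_inter h0 W
  have := hA.sixteen_le
  omega

/-! ### Closure under addition -/

/-- Four vectors of `A` in a plane form a parallelogram: `A` contains a vector `y + c • z` and a
vector `z + d • y`, and there is only room for one of them. -/
theorem add_mem_of_card_eq_four (hA : FewDirections F h k q A) (h0 : 0 ∈ A) {y z : V} (hy : y ∈ A)
    (hz : z ∈ A) (hy0 : y ≠ 0) (hz0 : z ≠ 0) (hyz : y ≠ z) {W : Submodule F V}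
    (hyW : y ∈ W) (hzW : z ∈ W) (hcard : #{v ∈ A | v ∈ W} = 4) : y + z ∈ A := by
  have hzy := hA.notMem_span h0 hy hz hy0 hz0 hyz
  have hli : ∀ a b : F, a • y + b • z = 0 → a = 0 ∧ b = 0 := by
    refine LinearIndependent.pair_iff.1 ((LinearIndependent.pair_iff' hy0).2 fun a ha => hzy ?_)
    exact Submodule.mem_span_singleton.2 ⟨a, ha⟩
  have step : ∀ u ∈ A, ∀ v ∈ A, v ≠ 0 → ∃ c : F, c ≠ 0 ∧ u + c • v ∈ A := by
    intro u hu v hv hv0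
    have hmem : Submodule.span F {v} ∈ dirs F A := by
      simpa using span_sub_mem_dirs (F := F) hv h0 hv0
    obtain ⟨w, hw, hwu, hspan⟩ := hA.exists_span_sub_eq hu hmem
    have h₁ : w - u ∈ Submodule.span F {v} := hspan ▸ Submodule.mem_span_singleton_self _
    obtain ⟨c, hc⟩ := Submodule.mem_span_singleton.1 h₁
    refine ⟨c, fun hc0 => hwu ?_, ?_⟩
    · rw [hc0, zero_smul, eq_comm, sub_eq_zero] at hc
      exact hc
    · rwa [hc, add_sub_cancel]
  obtain ⟨c, hc0, hc⟩ := step y hy z hz hz0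
  obtain ⟨d, hd0, hd⟩ := step z hz y hy hy0
  by_cases heq : y + c • z = z + d • y
  · have h₁ : (1 - d) • y + (c - 1) • z = 0 := by
      linear_combination (norm := module) heq
    have h₂ : c = 1 := sub_eq_zero.1 (hli _ _ h₁).2
    rwa [h₂, one_smul] at hc
  · have hnot : ∀ a b : F, a • y + b • z = 0 → b ≠ 0 → False := fun a b hab hb =>
      hb (hli a b hab).2
    have hnot' : ∀ a b : F, a • y + b • z = 0 → a ≠ 0 → False := fun a b hab ha =>
      ha (hli a b hab).1
    have hsub : ({0, y, z, y + c • z, z + d • y} : Finset V) ⊆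
        ({v ∈ A | v ∈ W} : Finset V) := by
      intro w hw
      simp only [mem_insert, mem_singleton] at hw
      rcases hw with rfl | rfl | rfl | rfl | rfl
      · simp [h0]
      · simp [hy, hyW]
      · simp [hz, hzW]
      · exact mem_filter.2 ⟨hc, W.add_mem hyW (W.smul_mem c hzW)⟩
      · exact mem_filter.2 ⟨hd, W.add_mem hzW (W.smul_mem d hyW)⟩
    have h5 := card_le_card hsub
    rw [hcard, card_insert_of_notMem, card_insert_of_notMem, card_insert_of_notMem,
      card_insert_of_notMem, card_singleton] at h5
    · omega
    · simpa using heq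
    · simp only [mem_insert, mem_singleton, not_or]
      refine ⟨fun h => hnot' 1 (c - 1) ?_ one_ne_zero, fun h => hnot' d 0 ?_ hd0⟩
      · linear_combination (norm := module) -h
      · linear_combination (norm := module) -h
    · simp only [mem_insert, mem_singleton, not_or]
      refine ⟨hyz, fun h => hnot 0 c ?_ hc0, fun h => hnot (d - 1) 1 ?_ one_ne_zero⟩
      · linear_combination (norm := module) -h
      · linear_combination (norm := module) -h
    · simp only [mem_insert, mem_singleton, not_or]
      refine ⟨hy0.symm, hz0.symm, fun h => hnot' 1 c ?_ one_ne_zero,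
        fun h => hnot d 1 ?_ one_ne_zero⟩
      · linear_combination (norm := module) -h
      · linear_combination (norm := module) -h

/-- At most `q + 1` planes of a three-dimensional space pass through one of its lines. -/
theorem card_planes_through_le {S : Submodule F V} (hS : Module.finrank F S ≤ 3) {x : V}
    (hx0 : x ≠ 0) (hxS : x ∈ S) {T : Finset V} (hT : ∀ z ∈ T, z ∈ S ∧ z ∉ Submodule.span F {x}) :
    #(T.image fun z => Submodule.span F {x} ⊔ Submodule.span F {z}) ≤ Fintype.card F + 1 := by
  set f : V → Submodule F V := fun z => Submodule.span F {x} ⊔ Submodule.span F {z} with hf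
  set p := Fintype.card F with hp
  have hp1 : 1 < p := Fintype.one_lt_card
  have hdiff : ∀ W : Submodule F V, x ∈ W →
      #(({v : V | v ∈ W} : Finset V) \ ({v : V | v ∈ Submodule.span F {x}} : Finset V)) =
        p ^ Module.finrank F W - p := by
    intro W hW
    rw [card_sdiff_of_subset, card_filter_mem_submodule, card_filter_mem_submodule,
      finrank_span_singleton hx0, pow_one]
    intro v hv
    simp only [mem_filter, mem_univ, true_and] at hv ⊢
    exact (Submodule.span_singleton_le_iff_mem _ _).2 hW hv
  have hcount : (p ^ 2 - p) * #(T.image f) ≤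
      #{v ∈ ({v : V | v ∈ S} : Finset V) \ ({v : V | v ∈ Submodule.span F {x}} : Finset V) |
        f v ∈ T.image f} := by
    refine mul_card_image_le_card_of_maps_to (f := f) (fun v hv => (mem_filter.1 hv).2) _
      fun W hW => ?_
    obtain ⟨z, hz, rfl⟩ := mem_image.1 hW
    have hr := finrank_sup_span_singleton hx0 (hT z hz).2
    rw [← hr, ← hdiff _ mem_sup_left]
    refine card_le_card fun v hv => ?_
    simp only [mem_sdiff, mem_filter, mem_univ, true_and] at hv ⊢
    have hle : f z ≤ S := by
      refine sup_le ?_ ?_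
      · simpa using hxS
      · simpa using (hT z hz).1
    have heq : f v = f z := sup_span_singleton_eq hx0 hv.2 hr mem_sup_left hv.1
    exact ⟨⟨⟨hle hv.1, hv.2⟩, heq ▸ hW⟩, heq⟩
  have h₂ := hcount.trans (card_le_card (filter_subset _ _))
  rw [hdiff S hxS] at h₂
  have h₃ : (p ^ 2 - p) * #(T.image f) ≤ (p ^ 2 - p) * (p + 1) := by
    refine h₂.trans ?_
    have h₄ : p ^ Module.finrank F S ≤ p ^ 3 := Nat.pow_le_pow_right (by omega) hS
    have h₅ : (p ^ 2 - p) * (p + 1) = p ^ 3 - p := by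
      have : p ≤ p ^ 2 := Nat.le_self_pow (by omega) p
      have : p ≤ p ^ 3 := Nat.le_self_pow (by omega) p
      zify [‹p ≤ p ^ 2›, ‹p ≤ p ^ 3›]
      ring
    omega
  refine Nat.le_of_mul_le_mul_left h₃ ?_
  have : p < p ^ 2 := lt_self_pow₀ hp1 (by omega)
  omega

/-- Two planes that meet `A` in `q` vectors have no nonzero vector in common.  Otherwise they
span a space of dimension at most three, in which the nonzero vectors of `A`, with the traces of
the planes through `0`, form a linear space with two blocks of size `q - 1`. -/
theorem big_plane_unique (hA : FewDirections F h k q A) (h0 : 0 ∈ A) {y : V}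
    (hy0 : y ≠ 0) {W₁ W₂ : Submodule F V} (hW₁ : Module.finrank F W₁ = 2)
    (hW₂ : Module.finrank F W₂ = 2) (hy₁ : y ∈ W₁) (hy₂ : y ∈ W₂)
    (hc₁ : #{v ∈ A | v ∈ W₁} = q) (hc₂ : #{v ∈ A | v ∈ W₂} = q) : W₁ = W₂ := by
  have hq := hA.sixteen_le
  set S := W₁ ⊔ W₂ with hS
  have hS3 : Module.finrank F S ≤ 3 := by
    have h₁ := Submodule.finrank_sup_add_finrank_inf_eq W₁ W₂
    have h₂ : Module.finrank F (Submodule.span F {y}) ≤ Module.finrank F ↥(W₁ ⊓ W₂) :=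
      Submodule.finrank_mono (by simp [hy₁, hy₂])
    rw [finrank_span_singleton hy0] at h₂
    rw [← hS] at h₁
    omega
  set D : Finset V := {v ∈ A | v ∈ S ∧ v ≠ 0} with hD
  set 𝓑 : Finset (Finset V) := D.offDiag.image fun p =>
    {v ∈ D | v ∈ Submodule.span F {p.1} ⊔ Submodule.span F {p.2}} with h𝓑
  have memD : ∀ {v}, v ∈ D → v ∈ A ∧ v ∈ S ∧ v ≠ 0 := fun hv => mem_filter.1 hv
  have indep : ∀ {u v}, u ∈ D → v ∈ D → u ≠ v → v ∉ Submodule.span F {u} := fun hu hv huv =>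
    hA.notMem_span h0 (memD hu).1 (memD hv).1 (memD hu).2.2 (memD hv).2.2 huv
  -- the trace of a subspace on `D` lacks only the vector `0` of its trace on `A`
  have htrace : ∀ W ≤ S, #{v ∈ D | v ∈ W} = #{v ∈ A | v ∈ W} - 1 := by
    intro W hW
    rw [← card_erase_of_mem (s := {v ∈ A | v ∈ W}) (a := 0) (by simp [h0])]
    congr 1
    ext v
    simp only [hD, mem_filter, mem_erase]
    exact ⟨fun h => ⟨h.1.2.2, h.1.1, h.2⟩, fun h => ⟨⟨h.2.1, hW h.2.2, h.1⟩, h.2.2⟩⟩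
  have block : ∀ {W : Submodule F V}, Module.finrank F W = 2 → ∀ {u v}, u ∈ D → v ∈ D → u ≠ v →
      u ∈ W → v ∈ W → ({v ∈ D | v ∈ W} : Finset V) ∈ 𝓑 := by
    intro W hW u v hu hv huv huW hvW
    refine mem_image.2 ⟨(u, v), mem_offDiag.2 ⟨hu, hv, huv⟩, ?_⟩
    rw [sup_span_singleton_eq (memD hu).2.2 (indep hu hv huv) hW huW hvW]
  have plane : ∀ B ∈ 𝓑, ∃ W : Submodule F V, Module.finrank F W = 2 ∧ W ≤ S ∧
      B = ({v ∈ D | v ∈ W} : Finset V) ∧ ∃ u ∈ D, ∃ v ∈ D, u ≠ v ∧ u ∈ W ∧ v ∈ W := by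
    intro B hB
    obtain ⟨⟨u, v⟩, hp, rfl⟩ := mem_image.1 hB
    obtain ⟨hu, hv, huv⟩ := mem_offDiag.1 hp
    refine ⟨_, finrank_sup_span_singleton (memD hu).2.2 (indep hu hv huv), sup_le ?_ ?_, rfl,
      u, hu, v, hv, huv, mem_sup_left, mem_sup_right⟩
    · simpa using (memD hu).2.1
    · simpa using (memD hv).2.1
  have huniqW : ∀ W W' : Submodule F V, Module.finrank F W = 2 → Module.finrank F W' = 2 →
      ∀ u ∈ D, ∀ v ∈ D, u ≠ v → u ∈ W → v ∈ W → u ∈ W' → v ∈ W' → W = W' := by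
    intro W W' hW hW' u hu v hv huv h₁ h₂ h₃ h₄
    rw [← sup_span_singleton_eq (memD hu).2.2 (indep hu hv huv) hW h₁ h₂,
      ← sup_span_singleton_eq (memD hu).2.2 (indep hu hv huv) hW' h₃ h₄]
  have hsub : ∀ B ∈ 𝓑, B ⊆ D := by
    intro B hB
    obtain ⟨W, -, -, rfl, -⟩ := plane B hB
    exact filter_subset _ _
  have hcov : ∀ x ∈ D, ∀ y ∈ D, x ≠ y → ∃ B ∈ 𝓑, x ∈ B ∧ y ∈ B := by
    intro u hu v hv huv
    refine ⟨_, mem_image.2 ⟨(u, v), mem_offDiag.2 ⟨hu, hv, huv⟩, rfl⟩, ?_, ?_⟩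
    · exact mem_filter.2 ⟨hu, mem_sup_left⟩
    · exact mem_filter.2 ⟨hv, mem_sup_right⟩
  have huniq : ∀ B ∈ 𝓑, ∀ B' ∈ 𝓑, ∀ x y, x ≠ y → x ∈ B → y ∈ B → x ∈ B' → y ∈ B' →
      B = B' := by
    intro B hB B' hB' u v huv h₁ h₂ h₃ h₄
    obtain ⟨W, hW, -, rfl, -⟩ := plane B hB
    obtain ⟨W', hW', -, rfl, -⟩ := plane B' hB'
    rw [mem_filter] at h₁ h₂ h₃ h₄
    rw [huniqW W W' hW hW' u h₁.1 v h₂.1 huv h₁.2 h₂.2 h₃.2 h₄.2]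
  have hsize : ∀ B ∈ 𝓑, #B = 3 ∨ #B = q - 1 := by
    intro B hB
    obtain ⟨W, hW, hWS, rfl, u, hu, v, hv, huv, huW, hvW⟩ := plane B hB
    rw [htrace W hWS]
    have := hA.card_plane_inter h0 (memD hu).1 (memD hv).1 (memD hu).2.2 (memD hv).2.2 huv hW
      huW hvW
    omega
  have hdeg : ∀ x ∈ D, #{B ∈ 𝓑 | x ∈ B} ≤ q + 1 := by
    intro x hx
    have h₁ := card_planes_through_le hS3 (memD hx).2.2 (memD hx).2.1 (T := D.erase x)
      (fun z hz => ⟨(memD (mem_erase.1 hz).2).2.1,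
        indep hx (mem_erase.1 hz).2 (mem_erase.1 hz).1.symm⟩)
    rw [hA.card_field] at h₁
    refine le_trans (le_trans (card_le_card fun B hB => ?_)
      (card_image_le (s := (D.erase x).image fun z =>
        Submodule.span F {x} ⊔ Submodule.span F {z})
        (f := fun W : Submodule F V => ({v ∈ D | v ∈ W} : Finset V)))) h₁
    obtain ⟨hB, hxB⟩ := mem_filter.1 hB
    obtain ⟨W, hW, hWS, rfl, u, hu, v, hv, huv, huW, hvW⟩ := plane B hB
    have hxW := (mem_filter.1 hxB).2
    obtain ⟨z, hz, hzx, hzW⟩ : ∃ z ∈ D, z ≠ x ∧ z ∈ W := by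
      by_cases hux : u = x
      · exact ⟨v, hv, fun hvx => huv (hux.trans hvx.symm), hvW⟩
      · exact ⟨u, hu, hux, huW⟩
    refine mem_image.2 ⟨W, mem_image.2 ⟨z, mem_erase.2 ⟨hzx, hz⟩, ?_⟩, rfl⟩
    exact sup_span_singleton_eq (memD hx).2.2 (indep hx hz hzx.symm) hW hxW hzW
  obtain ⟨e, he⟩ := hA.card_inter_eq_two_pow h0 S
  have hcard : #D + 1 = 2 ^ e := by
    have h₁ := htrace S le_rfl
    rw [filter_true_of_mem fun v hv => (memD hv).2.1] at h₁
    have : 0 < 2 ^ e := by positivity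
    omega
  have h₁ : #{v ∈ D | v ∈ W₁} = q - 1 := by rw [htrace W₁ le_sup_left, hc₁]
  have h₂ : #{v ∈ D | v ∈ W₂} = q - 1 := by rw [htrace W₂ le_sup_right, hc₂]
  have two : ∀ W : Submodule F V, #{v ∈ D | v ∈ W} = q - 1 →
      ∃ u ∈ D, ∃ v ∈ D, u ≠ v ∧ u ∈ W ∧ v ∈ W := by
    intro W hW
    obtain ⟨u, hu, v, hv, huv⟩ := one_lt_card.1 (show 1 < #{v ∈ D | v ∈ W} by omega)
    rw [mem_filter] at hu hv
    exact ⟨u, hu.1, v, hv.1, huv, hu.2, hv.2⟩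
  obtain ⟨u, hu, v, hv, huv, hu₁, hv₁⟩ := two W₁ h₁
  obtain ⟨u', hu', v', hv', huv', hu₂, hv₂⟩ := two W₂ h₂
  have heq := big_block_unique hA.four_le hA.q_eq hsub hcov huniq hsize hdeg hcard
    (block hW₁ hu hv huv hu₁ hv₁) (block hW₂ hu' hv' huv' hu₂ hv₂) h₁ h₂
  have hu₂ : u ∈ ({v ∈ D | v ∈ W₂} : Finset V) := heq ▸ mem_filter.2 ⟨hu, hu₁⟩
  have hv₂ : v ∈ ({v ∈ D | v ∈ W₂} : Finset V) := heq ▸ mem_filter.2 ⟨hv, hv₁⟩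
  exact huniqW W₁ W₂ hW₁ hW₂ u hu v hv huv hu₁ hv₁ (mem_filter.1 hu₂).2 (mem_filter.1 hv₂).2

/-- If the plane of `y` and `z` meets `A` in four vectors, these form a parallelogram.  If it meets
`A` in `q` vectors, take `w ∈ A` outside: the sums `y + w`, `z + (y + w)` and `w + (y + z + w)`
are formed in planes that share a nonzero vector with the first plane, and so meet `A` in
four vectors only. -/
theorem add_mem [CharP F 2] (hA : FewDirections F h k q A) (h0 : 0 ∈ A) {y z : V} (hy : y ∈ A)
    (hz : z ∈ A) : y + z ∈ A := by
  have htwo : ∀ v : V, v + v = 0 := fun v => by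
    rw [← two_smul F, CharTwo.two_eq_zero, zero_smul]
  by_cases hy0 : y = 0
  · rwa [hy0, zero_add]
  by_cases hz0 : z = 0
  · rwa [hz0, add_zero]
  by_cases hyz : y = z
  · rwa [hyz, htwo]
  set W := Submodule.span F {y} ⊔ Submodule.span F {z} with hWdef
  have hyW : y ∈ W := mem_sup_left
  have hzW : z ∈ W := mem_sup_right
  have hW : Module.finrank F W = 2 :=
    finrank_sup_span_singleton hy0 (hA.notMem_span h0 hy hz hy0 hz0 hyz)
  rcases hA.card_plane_inter h0 hy hz hy0 hz0 hyz hW hyW hzW with h4 | hq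
  · exact hA.add_mem_of_card_eq_four h0 hy hz hy0 hz0 hyz hyW hzW h4
  obtain ⟨w, hw, hwW⟩ : ∃ w ∈ A, w ∉ W := by
    by_contra hcon
    push Not at hcon
    rw [filter_true_of_mem hcon, hA.card_eq] at hq
    exact hA.lt_pow.ne' hq
  have step : ∀ u ∈ A, ∀ v ∈ A, u ≠ 0 → v ≠ 0 → u ≠ v → u ∉ W →
      (∃ p ∈ W, p ≠ 0 ∧ p ∈ Submodule.span F {u} ⊔ Submodule.span F {v}) → u + v ∈ A := by
    rintro u hu v hv hu0 hv0 huv huW ⟨p, hpW, hp0, hp⟩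
    have hr := finrank_sup_span_singleton hu0 (hA.notMem_span h0 hu hv hu0 hv0 huv)
    rcases hA.card_plane_inter h0 hu hv hu0 hv0 huv hr mem_sup_left mem_sup_right with h4 | h5
    · exact hA.add_mem_of_card_eq_four h0 hu hv hu0 hv0 huv mem_sup_left mem_sup_right h4
    · refine absurd ?_ huW
      rw [hA.big_plane_unique h0 hp0 hW hr hpW hp hq h5]
      exact mem_sup_left
  have ne : ∀ {u v : V}, u ∉ W → v ∈ W → u ≠ v := fun hu hv h => hu (h ▸ hv)
  have h₁ : w + y ∈ A := step w hw y hy (ne hwW W.zero_mem) hy0 (ne hwW hyW) hwW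
    ⟨y, hyW, hy0, mem_sup_right⟩
  have hwyW : w + y ∉ W := fun h => hwW ((W.add_mem_iff_left hyW).1 h)
  have h₂ : w + y + z ∈ A := step _ h₁ z hz (ne hwyW W.zero_mem) hz0 (ne hwyW hzW) hwyW
    ⟨z, hzW, hz0, mem_sup_right⟩
  have hwyzW : w + y + z ∉ W := fun h => hwyW ((W.add_mem_iff_left hzW).1 h)
  have hyz0 : y + z ≠ 0 := fun h => hyz (by
    rw [eq_neg_of_add_eq_zero_left h, neg_eq_of_add_eq_zero_left (htwo z)])
  have hsum : w + y + z + w = y + z := by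
    rw [add_assoc w y z, add_right_comm, htwo, zero_add]
  rw [← hsum]
  refine step _ h₂ w hw (ne hwyzW W.zero_mem) (ne hwW W.zero_mem) (fun h => hyz0 ?_) hwyzW
    ⟨y + z, W.add_mem hyW hzW, hyz0, ?_⟩
  · rw [add_assoc] at h
    exact add_eq_left.1 h
  · rw [← hsum]
    exact Submodule.add_mem _ mem_sup_left mem_sup_right

end FewDirections

end AffineSets

/-! ### Affine points as vectors -/

section Transfer

open Finset
open scoped Classical

variable {F V : Type*} [Field F] [AddCommGroup V] [Module F V]

/-- The set `A` is a coset of an `𝔽₂`-subspace of dimension `h k` whose nonzero vectors span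
different lines over `F`. -/
theorem FewDirections.exists_submodule [Fintype F] [Fintype V] [CharP F 2] [Module (ZMod 2) V]
    {h k q : ℕ} {A : Finset V} (hA : FewDirections F h k q A) {w₀ : V} (hw₀ : w₀ ∈ A) :
    ∃ U : Submodule (ZMod 2) V, (∀ v, v ∈ A ↔ v - w₀ ∈ U) ∧
      (∀ u ∈ U, ∀ v ∈ U, u ≠ 0 → v ≠ 0 → Submodule.span F {u} = Submodule.span F {v} → u = v) ∧
      Module.finrank (ZMod 2) U = h * k := by
  have hB := hA.image_sub w₀
  have h0 : (0 : V) ∈ A.image (· - w₀) := mem_image.2 ⟨w₀, hw₀, sub_self _⟩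
  let U : Submodule (ZMod 2) V :=
    { carrier := A.image (· - w₀)
      add_mem' := fun ha hb => hB.add_mem h0 ha hb
      zero_mem' := h0
      smul_mem' := by
        intro c v hv
        fin_cases c
        · change (0 : ZMod 2) • v ∈ _
          rw [zero_smul]; exact h0
        · change (1 : ZMod 2) • v ∈ _
          rw [one_smul]; exact hv }
  have hU : ∀ v, v ∈ U ↔ v ∈ A.image (· - w₀) := fun v => Iff.rfl
  refine ⟨U, fun v => ?_, fun u hu v hv hu0 hv0 heq => ?_, ?_⟩
  · rw [hU, mem_image]
    exact ⟨fun hv => ⟨v, hv, rfl⟩, fun ⟨a, ha, hav⟩ => sub_left_injective hav ▸ ha⟩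
  · refine hB.injOn_span_sub h0 (mem_erase.2 ⟨hu0, hu⟩) (mem_erase.2 ⟨hv0, hv⟩) ?_
    simpa using heq
  · have h₁ := Module.natCard_eq_pow_finrank (K := ZMod 2) (V := U)
    have h₂ : Nat.card U = #(A.image (· - w₀)) := Nat.subtype_card _ hU
    rw [h₂, hB.card_eq, hB.q_eq, ← pow_mul, Nat.card_zmod] at h₁
    exact (Nat.pow_right_injective le_rfl h₁).symm

/-- The vectors on which the linear form `φ` takes the value `1` and that represent points of
`Q`. -/
def affineVectors (φ : V →ₗ[F] F) (Q : Set (ℙ F V)) : Set V :=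
  {w | φ w = 1 ∧ ∃ hw : w ≠ 0, Projectivization.mk F w hw ∈ Q}

variable {φ : V →ₗ[F] F} {H : Submodule F V} {Q : Set (ℙ F V)}

theorem mk_mem_pointsOf {W : Submodule F V} {v : V} (hv : v ≠ 0) :
    Projectivization.mk F v hv ∈ pointsOf W ↔ v ∈ W := by
  change (Projectivization.mk F v hv).submodule ≤ W ↔ _
  rw [Projectivization.submodule_mk, Submodule.span_singleton_le_iff_mem]

theorem exists_rep_affineVectors (hφ : LinearMap.ker φ = H) (hQ : ∀ P ∈ Q, P ∉ pointsOf H)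
    {P : ℙ F V} (hP : P ∈ Q) :
    ∃ w ∈ affineVectors φ Q, ∃ hw : w ≠ 0, Projectivization.mk F w hw = P := by
  induction P using Projectivization.ind with
  | h v hv =>
    have h₁ : φ v ≠ 0 := fun h0 => hQ _ hP ((mk_mem_pointsOf hv).2 (hφ ▸ h0))
    have h₂ : (φ v)⁻¹ • v ≠ 0 := smul_ne_zero (inv_ne_zero h₁) hv
    have h₃ : Projectivization.mk F _ h₂ = Projectivization.mk F v hv :=
      (Projectivization.mk_eq_mk_iff' F _ _ h₂ hv).2 ⟨_, rfl⟩
    exact ⟨_, ⟨by simp [h₁], h₂, h₃ ▸ hP⟩, h₂, h₃⟩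

theorem eq_of_mk_eq {v w : V} (hv : v ≠ 0) (hw : w ≠ 0) (hv1 : φ v = 1) (hw1 : φ w = 1)
    (heq : Projectivization.mk F v hv = Projectivization.mk F w hw) : v = w := by
  obtain ⟨c, rfl⟩ := (Projectivization.mk_eq_mk_iff' F _ _ hv hw).1 heq
  rw [map_smul, hw1, smul_eq_mul, mul_one] at hv1
  rw [hv1, one_smul]

theorem ncard_affineVectors (hφ : LinearMap.ker φ = H) (hQ : ∀ P ∈ Q, P ∉ pointsOf H) :
    (affineVectors φ Q).ncard = Q.ncard := by
  refine Set.ncard_congr (fun w hw => Projectivization.mk F w hw.2.1) (fun w hw => hw.2.2)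
    (fun v w hv hw heq => eq_of_mk_eq hv.2.1 hw.2.1 hv.1 hw.1 heq) fun P hP => ?_
  obtain ⟨w, hw, hw0, rfl⟩ := exists_rep_affineVectors hφ hQ hP
  exact ⟨w, hw, rfl⟩

theorem mem_directions_iff (hφ : LinearMap.ker φ = H) (hQ : ∀ P ∈ Q, P ∉ pointsOf H) {R : ℙ F V} :
    R ∈ directions H Q ↔ ∃ x ∈ affineVectors φ Q, ∃ y ∈ affineVectors φ Q, x ≠ y ∧
      R.submodule = Submodule.span F {x - y} := by
  constructor
  · rintro ⟨hRH, P₁, hP₁, P₂, hP₂, hne, hR⟩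
    obtain ⟨x, hx, hx0, rfl⟩ := exists_rep_affineVectors hφ hQ hP₁
    obtain ⟨y, hy, hy0, rfl⟩ := exists_rep_affineVectors hφ hQ hP₂
    have hxy : x ≠ y := by
      rintro rfl
      exact hne rfl
    refine ⟨x, hx, y, hy, hxy, ?_⟩
    induction R using Projectivization.ind with
    | h v hv =>
      rw [mk_mem_pointsOf, ← hφ, LinearMap.mem_ker] at hRH
      simp only [Projectivization.submodule_mk, Submodule.span_singleton_le_iff_mem] at hR ⊢
      obtain ⟨_, ha, _, hb, hv'⟩ := Submodule.mem_sup.1 hR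
      obtain ⟨a, rfl⟩ := Submodule.mem_span_singleton.1 ha
      obtain ⟨b, rfl⟩ := Submodule.mem_span_singleton.1 hb
      have hab : a + b = 0 := by
        rw [← hv'] at hRH
        simpa [hx.1, hy.1] using hRH
      refine span_singleton_eq_of_mem hv (Submodule.mem_span_singleton.2 ⟨a, ?_⟩)
      rw [← hv', eq_neg_of_add_eq_zero_right hab, neg_smul, smul_sub, sub_eq_add_neg]
  · rintro ⟨x, ⟨hx1, hx0, hx⟩, y, ⟨hy1, hy0, hy⟩, hxy, hR⟩
    refine ⟨?_, _, hx, _, hy, fun heq => hxy (eq_of_mk_eq hx0 hy0 hx1 hy1 heq), ?_⟩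
    · change R.submodule ≤ H
      rw [hR, Submodule.span_singleton_le_iff_mem, ← hφ, LinearMap.mem_ker, map_sub, hx1, hy1,
        sub_self]
    · rw [hR, Submodule.span_singleton_le_iff_mem, Projectivization.submodule_mk,
        Projectivization.submodule_mk]
      exact Submodule.sub_mem _ mem_sup_left mem_sup_right

theorem ncard_inter_directions {A : Finset V} (hφ : LinearMap.ker φ = H)
    (hQ : ∀ P ∈ Q, P ∉ pointsOf H) (hA : (A : Set V) = affineVectors φ Q) (W : Submodule F V) :
    (pointsOf W ∩ directions H Q).ncard = #{L ∈ dirs F A | L ≤ W} := by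
  rw [← Set.ncard_coe_finset,
    ← Set.ncard_image_of_injective _ (Projectivization.submodule_injective (K := F) (V := V))]
  congr 1
  ext L
  simp only [Set.mem_image, Set.mem_inter_iff, mem_directions_iff hφ hQ, ← hA, mem_coe,
    coe_filter, Set.mem_ofPred_eq, mem_dirs]
  constructor
  · rintro ⟨P, ⟨hPW, hP⟩, rfl⟩
    exact ⟨hP, hPW⟩
  · rintro ⟨⟨x, hx, y, hy, hxy, rfl⟩, hW⟩
    refine ⟨Projectivization.mk F (x - y) (sub_ne_zero.2 hxy), ⟨?_, x, hx, y, hy, hxy, ?_⟩, ?_⟩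
    · rw [mk_mem_pointsOf]
      exact (Submodule.span_singleton_le_iff_mem _ _).1 hW
    · rw [Projectivization.submodule_mk]
    · rw [Projectivization.submodule_mk]

theorem exists_ker_eq [FiniteDimensional F V]
    (hH : Module.finrank F V = Module.finrank F H + 1) :
    ∃ φ : V →ₗ[F] F, LinearMap.ker φ = H := by
  have h₁ : Module.finrank F (V ⧸ H) = Module.finrank F F := by
    have := H.finrank_quotient_add_finrank
    rw [Module.finrank_self]
    omega
  refine ⟨(LinearEquiv.ofFinrankEq _ _ h₁).toLinearMap ∘ₗ H.mkQ, ?_⟩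
  rw [LinearEquiv.ker_comp, Submodule.ker_mkQ]

/-! ### Linear sets and the Barlotti-Cofman representation -/

section LinearSet

variable [Algebra (ZMod 2) F] [Module (ZMod 2) V] [IsScalarTower (ZMod 2) F V]

theorem restrictTo_eq_linearSet {D : Set (ℙ F V)} {U : Submodule (ZMod 2) V}
    (hD : ∀ P, P ∈ D ↔ ∃ u ∈ U, u ≠ 0 ∧ P.submodule = Submodule.span F {u}) :
    restrictTo H D =
      linearSet (ZMod 2) (F := F) (U.comap (H.subtype.restrictScalars (ZMod 2))) := by
  ext P
  induction P using Projectivization.ind with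
  | h v hv =>
    change Projectivization.map H.subtype H.injective_subtype (Projectivization.mk F v hv) ∈ D ↔ _
    rw [hD, Projectivization.map_mk, Projectivization.submodule_mk]
    have key : ∀ (u : H) (hu : u ≠ 0), Projectivization.mk F v hv = Projectivization.mk F u hu ↔
        Submodule.span F {(v : V)} = Submodule.span F {(u : V)} := by
      intro u hu
      rw [← Projectivization.submodule_injective.eq_iff, Projectivization.submodule_mk,
        Projectivization.submodule_mk, ← (Submodule.map_injective_of_injective
          H.injective_subtype).eq_iff, Submodule.map_span, Submodule.map_span,
        Set.image_singleton, Set.image_singleton, Submodule.subtype_apply, Submodule.subtype_apply]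
    constructor
    · rintro ⟨u, huU, hu0, heq⟩
      have huH : u ∈ H := by
        have h₁ : u ∈ Submodule.span F {(v : V)} :=
          (heq : Submodule.span F {(v : V)} = _) ▸ Submodule.mem_span_singleton_self u
        exact (Submodule.span_singleton_le_iff_mem _ _).2 v.2 h₁
      have hu0' : (⟨u, huH⟩ : H) ≠ 0 := fun h => hu0 (congrArg Subtype.val h)
      exact ⟨⟨u, huH⟩, hu0', huU, (key _ hu0').2 heq⟩
    · rintro ⟨u, hu0, huU, heq⟩
      exact ⟨u, huU, fun h => hu0 (Subtype.ext h), (key u hu0).1 heq⟩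

theorem finrank_comap_of_injective {E : Type*} [AddCommGroup E] [Module (ZMod 2) E]
    {f : E →ₗ[ZMod 2] V} (hf : Function.Injective f) {U : Submodule (ZMod 2) V}
    (hU : U ≤ LinearMap.range f) :
    Module.finrank (ZMod 2) (U.comap f) = Module.finrank (ZMod 2) U := by
  rw [(Submodule.equivMapOfInjective f hf (U.comap f)).finrank_eq, Submodule.map_comap_eq_of_le hU]

theorem isScattered_of_injOn_span {E : Type*} [AddCommGroup E] [Module F E] [Module (ZMod 2) E]
    [IsScalarTower (ZMod 2) F E] {U : Submodule (ZMod 2) E}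
    (hU : ∀ u ∈ U, ∀ v ∈ U, u ≠ 0 → v ≠ 0 → Submodule.span F {u} = Submodule.span F {v} → u = v) :
    IsScattered (ZMod 2) F U := by
  intro P
  induction P using Projectivization.ind with
  | h p hp =>
    rw [Projectivization.submodule_mk]
    by_cases hex : ∃ v ∈ U, v ≠ 0 ∧ v ∈ Submodule.span F {p}
    · obtain ⟨v, hvU, hv0, hvp⟩ := hex
      refine finrank_le_one ⟨v, hvU, hvp⟩ ?_
      rintro ⟨u, huU, hup⟩
      by_cases hu0 : u = 0
      · exact ⟨0, Subtype.ext (by simp [hu0])⟩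
      · refine ⟨1, Subtype.ext ?_⟩
        rw [one_smul]
        refine (hU u huU v hvU hu0 hv0 ?_).symm
        rw [span_singleton_eq_of_mem hu0 hup, span_singleton_eq_of_mem hv0 hvp]
    · refine finrank_le_one 0 ?_
      rintro ⟨u, huU, hup⟩
      by_cases hu0 : u = 0
      · exact ⟨0, Subtype.ext (by simp [hu0])⟩
      · exact absurd ⟨u, huU, hu0, hup⟩ hex

theorem mem_sup_span_singleton_zmod_two {U : Submodule (ZMod 2) V} {v w : V} :
    v ∈ U ⊔ Submodule.span (ZMod 2) {w} ↔ v ∈ U ∨ v - w ∈ U := by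
  constructor
  · intro hv
    obtain ⟨u, hu, _, hw, rfl⟩ := Submodule.mem_sup.1 hv
    obtain ⟨c, rfl⟩ := Submodule.mem_span_singleton.1 hw
    fin_cases c
    · left
      change u + (0 : ZMod 2) • w ∈ U
      simpa using hu
    · right
      change u + (1 : ZMod 2) • w - w ∈ U
      simpa using hu
  · rintro (hv | hv)
    · exact Submodule.mem_sup_left hv
    · simpa using Submodule.add_mem_sup hv (Submodule.mem_span_singleton_self w)

/-- The subspace is that of `U` and `w₀`: its vectors in the coset `U + w₀` give the lifted points,
and those in `U`, being differences of vectors of this coset, give the directions. -/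
theorem isProjSubspace_bcLift [FiniteDimensional (ZMod 2) V] {U : Submodule (ZMod 2) V} {w₀ : V}
    {n : ℕ} (hw₀ : w₀ ∈ affineVectors φ Q) (hU : ∀ v, v ∈ affineVectors φ Q ↔ v - w₀ ∈ U)
    (hn : Module.finrank (ZMod 2) U = n) :
    IsProjSubspace n (bcLift (ZMod 2) φ Q ∪
      directions (bcInfinity (ZMod 2) φ) (bcLift (ZMod 2) φ Q)) := by
  have hUker : ∀ u ∈ U, φ u = 0 := by
    intro u hu
    have h₁ : φ (u + w₀) = 1 := ((hU (u + w₀)).2 (by simpa using hu)).1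
    rw [map_add, hw₀.1] at h₁
    exact add_eq_right.1 h₁
  have hw₀U : w₀ ∉ U := fun h => zero_ne_one ((hUker w₀ h).symm.trans hw₀.1)
  have hmemb : ∀ {v}, φ v = 0 ∨ φ v = 1 → v ∈ bcSpace (ZMod 2) φ := by
    rintro v (h | h)
    · exact ⟨0, by simp [h]⟩
    · exact ⟨1, by simp [h]⟩
  have hle : U ⊔ Submodule.span (ZMod 2) {w₀} ≤
      LinearMap.range (bcSpace (ZMod 2) φ).subtype := by
    rw [Submodule.range_subtype]
    refine sup_le (fun u hu => hmemb (Or.inl (hUker u hu))) ?_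
    rw [Submodule.span_singleton_le_iff_mem]
    exact hmemb (Or.inr hw₀.1)
  have lift : ∀ (w : bcSpace (ZMod 2) φ) (hw : w ≠ 0), (w : V) ∈ affineVectors φ Q →
      Projectivization.mk (ZMod 2) w hw ∈ bcLift (ZMod 2) φ Q :=
    fun w hw hwA => ⟨w, hw, hwA.1, rfl, hwA.2.2⟩
  set W := (U ⊔ Submodule.span (ZMod 2) {w₀}).comap (bcSpace (ZMod 2) φ).subtype with hW
  have memW : ∀ w : bcSpace (ZMod 2) φ, w ∈ W ↔ (w : V) ∈ U ∨ (w : V) - w₀ ∈ U := fun w =>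
    mem_sup_span_singleton_zmod_two
  have lift_le : ∀ p ∈ bcLift (ZMod 2) φ Q, p.submodule ≤ W := by
    rintro p ⟨w, hw, hw1, rfl, hwQ⟩
    rw [Projectivization.submodule_mk, Submodule.span_singleton_le_iff_mem, memW]
    exact Or.inr ((hU w).1 ⟨hw1, _, hwQ⟩)
  refine ⟨W, ?_, Set.Subset.antisymm ?_ ?_⟩
  · rw [hW, finrank_comap_of_injective (Submodule.injective_subtype _) hle]
    have h₁ := Submodule.finrank_sup_add_finrank_inf_eq U (Submodule.span (ZMod 2) {w₀})
    have h₂ : U ⊓ Submodule.span (ZMod 2) {w₀} = ⊥ :=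
      (Submodule.disjoint_span_singleton_of_notMem hw₀U).eq_bot
    rw [h₂, finrank_bot, finrank_span_singleton (fun h : w₀ = 0 => hw₀U (h ▸ U.zero_mem)), hn] at h₁
    exact h₁
  · rintro p (hp | ⟨-, p₁, hp₁, p₂, hp₂, -, hp⟩)
    · exact lift_le p hp
    · exact hp.trans (sup_le (lift_le p₁ hp₁) (lift_le p₂ hp₂))
  · intro p hp
    induction p using Projectivization.ind with
    | h w hw =>
      rw [mk_mem_pointsOf, memW] at hp
      rcases hp with hp | hp
      · right
        set b : bcSpace (ZMod 2) φ := ⟨w₀, hmemb (Or.inr hw₀.1)⟩ with hb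
        have hb0 : b ≠ 0 := fun h => hw₀.2.1 (congrArg Subtype.val h)
        have hwb : ((w + b : bcSpace (ZMod 2) φ) : V) ∈ affineVectors φ Q :=
          (hU _).2 (by simpa [hb] using hp)
        have hwb0 : w + b ≠ 0 := fun h => hwb.2.1 (congrArg Subtype.val h)
        refine ⟨?_, _, lift _ hwb0 hwb, _, lift b hb0 hw₀, fun heq => hw ?_, ?_⟩
        · rw [mk_mem_pointsOf]
          exact hUker _ hp
        · obtain ⟨c, hc⟩ := (Projectivization.mk_eq_mk_iff' _ _ _ hwb0 hb0).1 heq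
          fin_cases c
          · exact absurd (hc.symm.trans (zero_smul _ b)) hwb0
          · exact add_eq_right.1 (hc.symm.trans (one_smul _ b))
        · simp only [Projectivization.submodule_mk, Submodule.span_singleton_le_iff_mem]
          simpa using Submodule.sub_mem _ (mem_sup_left (F := ZMod 2) (u := w + b) (v := b))
            mem_sup_right
      · exact Or.inl (lift w hw ((hU w).2 hp))

end LinearSet

end Transfer

end FinGeom

theorem mainTheorem4 (h k q : ℕ) (hh : 4 ≤ h) (hk : 2 ≤ k) (hq : q = 2 ^ h)
    (F : Type*) [Field F] [Algebra (ZMod 2) F] (hF : Nat.card F = q)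
    (V : Type*) [AddCommGroup V] [Module F V] [Module (ZMod 2) V] [IsScalarTower (ZMod 2) F V]
    (hV : Module.finrank F V = 2 * k + 1)
    (H : Submodule F V) (hH : Module.finrank F H = 2 * k)
    (Q D : Set (ℙ F V))
    (hQaff : ∀ P ∈ Q, P ∉ FinGeom.pointsOf H)
    (hQcard : Q.ncard = q ^ k)
    (hD : D = FinGeom.directions H Q)
    (hDcard : D.ncard = q ^ k - 1)
    (hlines : ∀ L : Set (ℙ F V), FinGeom.IsProjSubspace 1 L →
      (L ∩ D).ncard = 0 ∨ (L ∩ D).ncard = 1 ∨ (L ∩ D).ncard = 3 ∨ (L ∩ D).ncard = q - 1) :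
    FinGeom.IsLinearSet (ZMod 2) (h * k) (FinGeom.restrictTo H D) ∧
    FinGeom.IsMaximumScattered (ZMod 2) (FinGeom.restrictTo H D) ∧
    ∀ φ : V →ₗ[F] F, LinearMap.ker φ = H →
      FinGeom.IsProjSubspace (h * k)
        (FinGeom.bcLift (ZMod 2) φ Q ∪
          FinGeom.directions (FinGeom.bcInfinity (ZMod 2) φ) (FinGeom.bcLift (ZMod 2) φ Q)) := by
  classical
  have hqpos : 0 < q := by rw [hq]; positivity
  have : Finite F := Nat.finite_of_card_ne_zero (by omega)
  have : FiniteDimensional F V := FiniteDimensional.of_finrank_pos (by omega)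
  have : Finite V := Module.finite_of_finite F
  have : Fintype F := Fintype.ofFinite F
  have : Fintype V := Fintype.ofFinite V
  have : CharP F 2 := charP_of_injective_algebraMap (algebraMap (ZMod 2) F).injective 2
  -- normalised by `φ`, the points of `Q` become a coset of an `𝔽₂`-subspace
  have main : ∀ φ : V →ₗ[F] F, LinearMap.ker φ = H → ∃ w₀ ∈ FinGeom.affineVectors φ Q,
      ∃ U : Submodule (ZMod 2) V, (∀ v, v ∈ FinGeom.affineVectors φ Q ↔ v - w₀ ∈ U) ∧
      (∀ u ∈ U, ∀ v ∈ U, u ≠ 0 → v ≠ 0 → Submodule.span F {u} = Submodule.span F {v} → u = v) ∧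
      Module.finrank (ZMod 2) U = h * k := by
    intro φ hφ
    have hA : ((FinGeom.affineVectors φ Q).toFinset : Set V) = FinGeom.affineVectors φ Q :=
      Set.coe_toFinset _
    have hdirs := FinGeom.ncard_inter_directions hφ hQaff hA
    have hcard : (FinGeom.affineVectors φ Q).toFinset.card = q ^ k := by
      rw [← Set.ncard_coe_finset, hA, FinGeom.ncard_affineVectors hφ hQaff, hQcard]
    have hfew : FinGeom.FewDirections F h k q (FinGeom.affineVectors φ Q).toFinset := by
      refine ⟨hh, hk, hq, by rw [← hF, Nat.card_eq_fintype_card], hcard, ?_, fun W hW => ?_⟩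
      · have h₁ := hdirs ⊤
        rw [← hD, Finset.filter_true_of_mem fun L _ => le_top, Set.inter_eq_right.2, hDcard] at h₁
        · exact h₁.symm
        · exact fun P _ => (le_top : P.submodule ≤ ⊤)
      · rw [← hdirs W, ← hD]
        exact hlines _ ⟨W, hW, rfl⟩
    obtain ⟨w₀, hw₀⟩ : (FinGeom.affineVectors φ Q).toFinset.Nonempty :=
      Finset.card_pos.1 (by rw [hcard]; positivity)
    obtain ⟨U, hU, hinj, hrank⟩ := hfew.exists_submodule hw₀
    simp only [Set.mem_toFinset] at hw₀ hU
    exact ⟨w₀, hw₀, U, hU, hinj, hrank⟩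
  obtain ⟨φ, hφ⟩ := FinGeom.exists_ker_eq (F := F) (H := H) (by rw [hV, hH])
  obtain ⟨w₀, hw₀, U, hU, hinj, hrank⟩ := main φ hφ
  have hUA : ∀ u ∈ U, u + w₀ ∈ FinGeom.affineVectors φ Q := fun u hu =>
    (hU _).2 (by simpa using hu)
  have hDU : ∀ P, P ∈ D ↔ ∃ u ∈ U, u ≠ 0 ∧ P.submodule = Submodule.span F {u} := by
    intro P
    rw [hD, FinGeom.mem_directions_iff hφ hQaff]
    constructor
    · rintro ⟨x, hx, y, hy, hxy, hP⟩
      refine ⟨x - y, ?_, sub_ne_zero.2 hxy, hP⟩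
      simpa using U.sub_mem ((hU x).1 hx) ((hU y).1 hy)
    · rintro ⟨u, hu, hu0, hP⟩
      exact ⟨u + w₀, hUA u hu, w₀, hw₀, by simpa using hu0, by simpa using hP⟩
  have hUH : U ≤ LinearMap.range (H.subtype.restrictScalars (ZMod 2)) := by
    intro u hu
    have h₁ := (hUA u hu).1
    rw [map_add, hw₀.1] at h₁
    have h₂ : u ∈ H := by
      rw [← hφ, LinearMap.mem_ker]
      exact add_eq_right.1 h₁
    exact ⟨⟨u, h₂⟩, rfl⟩
  have hrank' := (FinGeom.finrank_comap_of_injective (U := U)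
    (f := H.subtype.restrictScalars (ZMod 2)) H.injective_subtype hUH).trans hrank
  have hset := FinGeom.restrictTo_eq_linearSet (H := H) hDU
  refine ⟨⟨_, hrank', hset⟩, ⟨_, hset, FinGeom.isScattered_of_injOn_span ?_, ?_⟩, ?_⟩
  · intro u hu v hv hu0 hv0 heq
    refine Subtype.ext (hinj u hu v hv (fun h => hu0 (Subtype.ext h))
      (fun h => hv0 (Subtype.ext h)) ?_)
    have := congrArg (Submodule.map H.subtype) heq
    simpa only [Submodule.map_span, Set.image_singleton, Submodule.subtype_apply] using this
  · have hFrank : Module.finrank (ZMod 2) F = h := by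
      have h₁ := Module.natCard_eq_pow_finrank (K := ZMod 2) (V := F)
      rw [hF, hq, Nat.card_zmod] at h₁
      exact (Nat.pow_right_injective le_rfl h₁).symm
    rw [hrank', hH, hFrank]
    ring
  · intro ψ hψ
    obtain ⟨w₁, hw₁, U₁, hU₁, -, hrank₁⟩ := main ψ hψ
    exact FinGeom.isProjSubspace_bcLift hw₁ hU₁ hrank₁
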